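/- Let $\kappa\in\mathbb{R}$ and, for $u\in(0,1)$, let $$g_{2}^{(\kappa)}(u):=\kappa\bigl(u\log u+(1-u)\log(1-u)\bigr)\begin{pmatrix}2\\ 1/3\end{pmatrix}+\begin{pmatrix}1\\ u(1-u)\end{pmatrix}.$$ Let $(X,Y)$ be an $\mathbb{R}^2$-valued random vector that solves the bivariate Quicksort fixed-point equation $$\begin{pmatrix}X\\Y\end{pmatrix}\stackrel{d}{=}U\begin{pmatrix}X^{(1)}\\Y^{(1)}\end{pmatrix}+(1-U)\begin{pmatrix}X^{(2)}\\Y^{(2)}\end{pmatrix}+g_2^{(\kappa)}(U),$$ where $\stackrel{d}{=}$ denotes equality in distribution, $(X^{(1)},Y^{(1)})$, $(X^{(2)},Y^{(2)})$ and $U$ are independent, $(X^{(1)},Y^{(1)})$ and $(X^{(2)},Y^{(2)})$ have the same distribution as $(X,Y)$, and $U$ is uniformly distributed on $(0,1)$. No moment assumption is made on $(X,Y)$. Then $(X,Y)$ admits, with respect to Lebesgue measure on $\mathbb{R}^2$, a bounded density $f\in\mathcal{C}^\infty(\mathbb{R}^2)$. For $\kappa=1$ this is the fixed-point equation of the joint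 limit law of the rescaled numbers of key comparisons and key exchanges of Quicksort; $\kappa=2$ gives the toll $(2u\log u+2(1-u)\log(1-u))(2,1/3)^T+(1,u(1-u))^T$. -/

import Mathlib

open MeasureTheory ProbabilityTheory
open scoped ContDiff

noncomputable section

/-- The plane with its Euclidean norm, inner product and Lebesgue measure. -/
abbrev Plane : Type := EuclideanSpace ℝ (Fin 2)

/-- The bivariate Quicksort toll function
`κ (u log u + (1 - u) log (1 - u)) (2, 1/3) + (1, u (1 - u))`.
The value `κ = 1` is the toll of the limit law of key comparisons and key exchanges (both
coordinates then have mean zero under the uniform law, and the first one is the classical toll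
`2 u log u + 2 (1 - u) log (1 - u) + 1`); the value `κ = 2` is the variant
`(2 u log u + 2 (1 - u) log (1 - u)) (2, 1/3) + (1, u (1 - u))`. -/
def bivariateToll (κ u : ℝ) : Plane :=
  (κ * (u * Real.log u + (1 - u) * Real.log (1 - u))) • !₂[2, 1 / 3] + !₂[1, u * (1 - u)]

/-- The random vector `Z = (X, Y)` solves the fixed-point equation
`Z =ᵈ U Z₁ + (1 - U) Z₂ + bivariateToll κ U`, where `Z₁`, `Z₂`, `U` are defined on a possibly
different probability space.  The two independence fields together say that `Z₁`, `Z₂`, `U` are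
mutually independent. -/
structure SolvesBivariateQuicksort (κ : ℝ) {Ω Ω' : Type*} [MeasurableSpace Ω] [MeasurableSpace Ω']
    (P : Measure Ω) (P' : Measure Ω') (Z : Ω → Plane) (Z₁ Z₂ : Ω' → Plane) (U : Ω' → ℝ) :
    Prop where
  identDistrib_fst : IdentDistrib Z₁ Z P' P
  identDistrib_snd : IdentDistrib Z₂ Z P' P
  uniform : pdf.IsUniform U (Set.Ioo 0 1) P' volume
  indep_copies : IndepFun Z₁ Z₂ P'
  indep_uniform : IndepFun (fun w => (Z₁ w, Z₂ w)) U P'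
  equation : IdentDistrib Z
    (fun w => U w • Z₁ w + (1 - U w) • Z₂ w + bivariateToll κ (U w)) P P'

end

/-!
Let `φ` be the modulus of the characteristic function of `Z`. Conditioning on `Z₁` and `Z₂` bounds
`φ ξ` by the mean of `|∫₀¹ exp (i h(u)) du|`, where
`h(u) = ⟪Z₁ - Z₂, ξ⟫ u + K (u log u + (1 - u) log (1 - u)) + B u (1 - u)`, `K = κ (2 ξ₀ + ξ₁ / 3)`
and `B = ξ₁`. By van der Corput's derivative tests these integrals stay below a constant `< 1` once
the three coefficients are large. The coefficients determine `ξ` when the first coordinate of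
`Z₁ - Z₂` is nonzero, which has positive probability because the toll does not vanish; hence
`φ ≤ η < 1` near infinity. No quantitative information on `Z` is needed.

Conditioning on `U` instead gives `φ ξ ≤ ∫₀¹ φ (u ξ) φ ((1 - u) ξ) du`. One of the two arguments has
norm at least `‖ξ‖ / 2` and the other one is large for most `u`, so doubling `‖ξ‖` multiplies the
bound by almost `η`. Thus `φ` tends to `0`, and the same argument with `η` arbitrarily small makes
`φ` decay faster than every power. Fourier inversion then yields the density.
-/

section FourierInversion

open Filter Topology Module
open scoped RealInnerProductSpace FourierTransform ComplexOrder

variable {V : Type*} [NormedAddCommGroup V] [InnerProductSpace ℝ V]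

/-- The Gaussian `v ↦ exp (-b ‖v‖²)` times the character `v ↦ exp (2πi ⟪x, v⟫)`; these are the test
functions against which a measure is compared with its Fourier inversion integral. -/
noncomputable def gaussianWave (b : ℝ) (x v : V) : ℂ :=
  Complex.exp (-b * ‖v‖ ^ 2 + 2 * Real.pi * Complex.I * ⟪x, v⟫)

theorem continuous_gaussianWave (b : ℝ) (x : V) : Continuous (gaussianWave b x) := by
  unfold gaussianWave
  fun_prop

theorem gaussianWave_eq_ofReal_exp_mul (b : ℝ) (x v : V) :
    gaussianWave b x v = Real.exp (-b * ‖v‖ ^ 2) *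
      Complex.exp (⟪v, (2 * Real.pi) • x⟫ * Complex.I) := by
  rw [gaussianWave, Complex.exp_add, inner_smul_right, real_inner_comm]
  push_cast
  ring_nf

variable [MeasurableSpace V]

/-- The Fourier transform of a measure, `w ↦ ∫ exp (-2πi ⟪x, w⟫) dμ x`: the characteristic function
rescaled to the normalisation of Mathlib's Fourier transform of functions. -/
noncomputable def measureFourier (μ : Measure V) (w : V) : ℂ := charFun μ (-(2 * Real.pi) • w)

theorem measureFourier_eq_fourierIntegral (μ : Measure V) :
    measureFourier μ = VectorFourier.fourierIntegral Real.fourierChar μ (innerₗ V) 1 := by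
  ext w
  simp only [measureFourier, charFun_eq_fourierIntegral', smul_smul]
  congr 1
  field_simp
  simp

variable {μ : Measure V}

theorem norm_pow_mul_norm_measureFourier_le {k : ℕ} {C : ℝ}
    (h : ∀ t : V, ‖t‖ ^ k * ‖charFun μ t‖ ≤ C) (w : V) : ‖w‖ ^ k * ‖measureFourier μ w‖ ≤ C := by
  refine le_trans ?_ (h (-(2 * Real.pi) • w))
  rw [measureFourier, norm_smul, norm_neg, Real.norm_of_nonneg (by positivity)]
  gcongr
  exact le_mul_of_one_le_left (norm_nonneg w) (by linarith [Real.pi_gt_three])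

theorem charFun_withDensity_ofReal {ν : Measure V} {ρ : V → ℝ} (hρ : Measurable ρ)
    (hρ' : ∀ x, 0 ≤ ρ x) (t : V) :
    charFun (ν.withDensity fun x => ENNReal.ofReal (ρ x)) t =
      ∫ x, ρ x * Complex.exp (⟪x, t⟫ * Complex.I) ∂ν := by
  rw [charFun_apply, integral_withDensity_eq_integral_toReal_smul hρ.ennreal_ofReal
    (ae_of_all _ fun _ => ENNReal.ofReal_lt_top)]
  simp only [ENNReal.toReal_ofReal (hρ' _), Complex.real_smul]

variable [BorelSpace V] [FiniteDimensional ℝ V]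

/-- The Fourier inversion integral of a measure: its density as soon as `measureFourier μ` is
integrable. -/
noncomputable def fourierDensity (μ : Measure V) (x : V) : ℝ := (𝓕⁻ (measureFourier μ) x).re

theorem abs_fourierDensity_le (x : V) : |fourierDensity μ x| ≤ ∫ w, ‖measureFourier μ w‖ :=
  (Complex.abs_re_le_norm _).trans (VectorFourier.norm_fourierIntegral_le_integral_norm ..)

theorem contDiff_fourierDensity {n : ℕ∞}
    (h : ∀ k : ℕ, k ≤ n → Integrable fun w : V => ‖w‖ ^ k * ‖measureFourier μ w‖) :
    ContDiff ℝ n (fourierDensity μ) := by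
  have fourier : ContDiff ℝ n (𝓕 (measureFourier μ)) := Real.contDiff_fourier h
  unfold fourierDensity
  simp only [Real.fourierInv_eq_fourier_neg]
  exact Complex.reCLM.contDiff.comp (fourier.comp contDiff_neg)

theorem continuous_fourierDensity (hΦ : Integrable (measureFourier μ)) :
    Continuous (fourierDensity μ) := by
  refine contDiff_zero.1 (contDiff_fourierDensity (n := 0) fun k hk => ?_)
  obtain rfl : k = 0 := by simpa using hk
  simpa only [pow_zero, one_mul] using hΦ.norm

variable [IsFiniteMeasure μ]

theorem continuous_measureFourier : Continuous (measureFourier μ) :=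
  continuous_charFun.comp (continuous_const_smul _)

theorem integrable_pow_mul_norm_measureFourier
    (h : ∀ k : ℕ, ∃ C : ℝ, ∀ t : V, ‖t‖ ^ k * ‖charFun μ t‖ ≤ C) (k : ℕ) :
    Integrable fun w : V => ‖w‖ ^ k * ‖measureFourier μ w‖ := by
  obtain ⟨C₁, h₁⟩ := h 0
  obtain ⟨C₂, h₂⟩ := h (k + (volume : Measure V).integrablePower)
  exact integrable_of_le_of_pow_mul_le
    (fun w => by simpa using norm_pow_mul_norm_measureFourier_le h₁ w)
    (norm_pow_mul_norm_measureFourier_le h₂) continuous_measureFourier.aestronglyMeasurable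

theorem integrable_measureFourier
    (h : ∀ k : ℕ, ∃ C : ℝ, ∀ t : V, ‖t‖ ^ k * ‖charFun μ t‖ ≤ C) :
    Integrable (measureFourier μ) := by
  rw [← integrable_norm_iff continuous_measureFourier.aestronglyMeasurable]
  simpa only [pow_zero, one_mul] using integrable_pow_mul_norm_measureFourier h 0

theorem integral_mul_measureFourier {ψ : V → ℂ} (hψ : Integrable ψ) :
    ∫ w, ψ w * measureFourier μ w = ∫ x, 𝓕 ψ x ∂μ := by
  have flip := VectorFourier.integral_fourierIntegral_smul_eq_flip (L := innerₗ V) (μ := μ)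
    (ν := volume) (f := 1) Real.continuous_fourierChar continuous_inner (integrable_const _) hψ
  simp only [← measureFourier_eq_fourierIntegral, flip_innerₗ, Pi.one_apply, one_mul,
    smul_eq_mul] at flip
  simpa only [mul_comm] using! flip

theorem integral_fourierInv_mul {f g : V → ℂ} (hf : Integrable f) (hg : Integrable g) :
    ∫ w, 𝓕⁻ f w * g w = ∫ w, f w * 𝓕⁻ g w := by
  have flip := VectorFourier.integral_fourierIntegral_smul_eq_flip (L := -innerₗ V) (μ := volume)
    (ν := volume) Real.continuous_fourierChar continuous_inner.neg hf hg
  have flip_neg : (-innerₗ V).flip = -innerₗ V := by ext x y; simp [real_inner_comm]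
  rw [flip_neg] at flip
  exact flip

theorem integral_eq_integral_mul_fourierInv_measureFourier (hΦ : Integrable (measureFourier μ))
    {χ : V → ℂ} (hc : Continuous χ) (hχ : Integrable χ) (hχ' : Integrable (𝓕 χ)) :
    ∫ x, χ x ∂μ = ∫ x, χ x * 𝓕⁻ (measureFourier μ) x := by
  have integrable_inv : Integrable (𝓕⁻ χ) := by
    simpa only [← Real.fourierInv_eq_fourier_neg] using hχ'.comp_neg
  rw [← integral_fourierInv_mul hχ hΦ, integral_mul_measureFourier integrable_inv,
    hc.fourier_fourierInv_eq hχ hχ']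

theorem integrable_gaussianWave {b : ℝ} (hb : 0 < b) (x : V) : Integrable (gaussianWave b x) :=
  GaussianFourier.integrable_cexp_neg_mul_sq_norm_add (by simpa) _ x

theorem fourier_gaussianWave {b : ℝ} (hb : 0 < b) (x v : V) :
    𝓕 (gaussianWave b x) v =
      ((Real.pi / b) ^ (finrank ℝ V / 2 : ℝ) * Real.exp (-Real.pi ^ 2 * ‖x - v‖ ^ 2 / b) : ℝ) := by
  unfold gaussianWave
  rw [fourier_gaussian_innerProductSpace' (by simpa)]
  push_cast [Complex.ofReal_cpow (show 0 ≤ Real.pi / b by positivity)]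
  rfl

theorem integrable_exp_neg_mul_sq_norm {b : ℝ} (hb : 0 < b) :
    Integrable fun v : V => Real.exp (-b * ‖v‖ ^ 2) := by
  refine (integrable_gaussianWave (V := V) hb 0).norm.congr (ae_of_all _ fun v => ?_)
  simp only [gaussianWave_eq_ofReal_exp_mul, norm_mul, Complex.norm_exp_ofReal_mul_I, mul_one,
    Complex.norm_real, Real.norm_eq_abs, Real.abs_exp]

theorem integrable_fourier_gaussianWave {b : ℝ} (hb : 0 < b) (x : V) :
    Integrable (𝓕 (gaussianWave b x)) := by
  have gaussian : Integrable fun v : V => Real.exp (-(Real.pi ^ 2 / b) * ‖x - v‖ ^ 2) :=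
    (integrable_exp_neg_mul_sq_norm (by positivity)).comp_sub_left x
  refine (gaussian.const_mul ((Real.pi / b) ^ (finrank ℝ V / 2 : ℝ))).ofReal.congr
    (ae_of_all _ fun v => ?_)
  have exponent : -(Real.pi ^ 2 / b) * ‖x - v‖ ^ 2 = -Real.pi ^ 2 * ‖x - v‖ ^ 2 / b := by ring
  beta_reduce
  rw [fourier_gaussianWave hb, exponent]
  rfl

theorem fourierInv_measureFourier_nonneg (hΦ : Integrable (measureFourier μ)) (x : V) :
    0 ≤ 𝓕⁻ (measureFourier μ) x := by
  have smoothed_nonneg {c : ℝ} (hc : 0 < c) :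
      0 ≤ ∫ w, gaussianWave c⁻¹ x w * measureFourier μ w := by
    rw [integral_mul_measureFourier (integrable_gaussianWave (inv_pos.2 hc) x)]
    simp only [fourier_gaussianWave (inv_pos.2 hc)]
    rw [integral_complex_ofReal, Complex.zero_le_real]
    positivity
  have tendsto_smoothed : Tendsto (fun c : ℝ => ∫ w, gaussianWave c⁻¹ x w * measureFourier μ w)
      atTop (𝓝 (𝓕⁻ (measureFourier μ) x)) := by
    have integrable_wave : Integrable fun w => 𝐞 ⟪w, x⟫ • measureFourier μ w := by
      simpa using (Real.fourierIntegral_convergent_iff (-x)).2 hΦ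
    convert! Real.tendsto_integral_cexp_sq_smul integrable_wave using 4 with c w
    · rw [gaussianWave, Circle.smul_def, Real.fourierChar_apply, real_inner_comm, Complex.exp_add]
      simp only [smul_eq_mul, Complex.ofReal_mul, Complex.ofReal_ofNat, Complex.ofReal_inv]
      ring_nf
    · rw [Real.fourierInv_eq]
  exact ge_of_tendsto tendsto_smoothed ((eventually_gt_atTop 0).mono fun c => smoothed_nonneg)

theorem ofReal_fourierDensity (hΦ : Integrable (measureFourier μ)) (x : V) :
    (fourierDensity μ x : ℂ) = 𝓕⁻ (measureFourier μ) x :=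
  (Complex.eq_re_of_ofReal_le (r := 0)
    (by simpa only [Complex.ofReal_zero] using fourierInv_measureFourier_nonneg hΦ x)).symm

theorem fourierDensity_nonneg (hΦ : Integrable (measureFourier μ)) (x : V) :
    0 ≤ fourierDensity μ x :=
  Complex.re_le_re (fourierInv_measureFourier_nonneg hΦ x)

theorem integral_gaussianWave_eq_integral_mul_fourierDensity
    (hΦ : Integrable (measureFourier μ)) {b : ℝ} (hb : 0 < b) (t : V) :
    ∫ x, gaussianWave b t x ∂μ = ∫ x, fourierDensity μ x * gaussianWave b t x := by
  simp only [ofReal_fourierDensity hΦ, mul_comm]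
  exact integral_eq_integral_mul_fourierInv_measureFourier hΦ (continuous_gaussianWave b t)
    (integrable_gaussianWave hb t) (integrable_fourier_gaussianWave hb t)

theorem withDensity_fourierDensity_mul_gaussian (hΦ : Integrable (measureFourier μ)) {b : ℝ}
    (hb : 0 < b) :
    volume.withDensity (fun x => ENNReal.ofReal (fourierDensity μ x * Real.exp (-b * ‖x‖ ^ 2))) =
      μ.withDensity fun x => ENNReal.ofReal (Real.exp (-b * ‖x‖ ^ 2)) := by
  have continuous_gaussian : Continuous fun x : V => Real.exp (-b * ‖x‖ ^ 2) := by fun_prop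
  have continuous_product :
      Continuous fun x : V => fourierDensity μ x * Real.exp (-b * ‖x‖ ^ 2) :=
    (continuous_fourierDensity hΦ).mul continuous_gaussian
  have integrable_vol : Integrable fun x : V => fourierDensity μ x * Real.exp (-b * ‖x‖ ^ 2) :=
    (integrable_exp_neg_mul_sq_norm hb).bdd_mul
      (continuous_fourierDensity hΦ).aestronglyMeasurable (ae_of_all _ abs_fourierDensity_le)
  have integrable_μ : Integrable (fun x : V => Real.exp (-b * ‖x‖ ^ 2)) μ :=
    Integrable.of_bound continuous_gaussian.aestronglyMeasurable 1 (ae_of_all _ fun x => by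
      rw [Real.norm_of_nonneg (Real.exp_nonneg _), Real.exp_le_one_iff, neg_mul]
      exact neg_nonpos.2 (by positivity))
  have := isFiniteMeasure_withDensity_ofReal integrable_vol.2
  have := isFiniteMeasure_withDensity_ofReal integrable_μ.2
  refine Measure.ext_of_charFun (funext fun t => ?_)
  obtain ⟨s, rfl⟩ : ∃ s : V, (2 * Real.pi) • s = t :=
    ⟨(2 * Real.pi)⁻¹ • t, smul_inv_smul₀ (by positivity) t⟩
  rw [charFun_withDensity_ofReal continuous_product.measurable
      fun x => mul_nonneg (fourierDensity_nonneg hΦ x) (Real.exp_nonneg _),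
    charFun_withDensity_ofReal continuous_gaussian.measurable fun x => Real.exp_nonneg _]
  simpa only [gaussianWave_eq_ofReal_exp_mul, Complex.ofReal_mul, mul_assoc] using
    (integral_gaussianWave_eq_integral_mul_fourierDensity hΦ hb s).symm

theorem withDensity_left_injective {X : Type*} [MeasurableSpace X] {g : X → ENNReal}
    (hg : Measurable g) (hg₀ : ∀ x, g x ≠ 0) (hg_top : ∀ x, g x ≠ ⊤) :
    Function.Injective fun ν : Measure X => ν.withDensity g := by
  intro ν₁ ν₂ h
  rw [← withDensity_inv_same hg (ae_of_all ν₁ hg₀) (ae_of_all ν₁ hg_top),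
    ← withDensity_inv_same hg (ae_of_all ν₂ hg₀) (ae_of_all ν₂ hg_top)]
  exact congrArg (fun ν : Measure X => ν.withDensity fun x => (g x)⁻¹) h

theorem withDensity_fourierDensity (hΦ : Integrable (measureFourier μ)) :
    volume.withDensity (fun x => ENNReal.ofReal (fourierDensity μ x)) = μ := by
  have measurable_gaussian :
      Measurable fun x : V => ENNReal.ofReal (Real.exp (-1 * ‖x‖ ^ 2)) := by fun_prop
  refine withDensity_left_injective measurable_gaussian
    (fun x => (ENNReal.ofReal_pos.2 (Real.exp_pos _)).ne') (fun x => ENNReal.ofReal_ne_top) ?_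
  beta_reduce
  rw [← withDensity_mul _ (continuous_fourierDensity hΦ).measurable.ennreal_ofReal
    measurable_gaussian, ← withDensity_fourierDensity_mul_gaussian hΦ one_pos]
  congr with x
  exact (ENNReal.ofReal_mul (fourierDensity_nonneg hΦ x)).symm

end FourierInversion

section OscillatoryIntegrals

open Set Filter

section DerivativeOfInverse

variable {f f' : ℝ → ℝ} {a b : ℝ}

theorem intervalIntegrable_deriv_div_sq (hab : a ≤ b)
    (hf : ∀ u ∈ Icc a b, HasDerivAt f (f' u) u) (hf₀ : ∀ u ∈ Icc a b, f u ≠ 0)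
    (hf' : ∀ u ∈ Icc a b, 0 ≤ f' u) :
    IntervalIntegrable (fun u => f' u / f u ^ 2) volume a b := by
  have hasDeriv (u) (hu : u ∈ Icc a b) : HasDerivAt (fun u => -(f u)⁻¹) (f' u / f u ^ 2) u :=
    ((hf u hu).fun_inv (hf₀ u hu)).fun_neg.congr_deriv (by ring)
  refine intervalIntegral.intervalIntegrable_deriv_of_nonneg (g := fun u => -(f u)⁻¹)
    (fun u hu => ?_) (fun u hu => ?_) fun u hu => ?_
  · exact (hasDeriv u (uIcc_of_le hab ▸ hu)).continuousAt.continuousWithinAt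
  all_goals
    rw [min_eq_left hab, max_eq_right hab] at hu
    have hu := Ioo_subset_Icc_self hu
  · exact hasDeriv u hu
  · exact div_nonneg (hf' u hu) (sq_nonneg _)

theorem integral_deriv_div_sq (hab : a ≤ b)
    (hf : ∀ u ∈ Icc a b, HasDerivAt f (f' u) u) (hf₀ : ∀ u ∈ Icc a b, f u ≠ 0)
    (hf' : ∀ u ∈ Icc a b, 0 ≤ f' u) :
    ∫ u in a..b, f' u / f u ^ 2 = (f a)⁻¹ - (f b)⁻¹ := by
  rw [intervalIntegral.integral_eq_sub_of_hasDerivAt (f := fun u => -(f u)⁻¹)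
    (fun u hu => ?_) (intervalIntegrable_deriv_div_sq hab hf hf₀ hf')]
  · ring
  · rw [uIcc_of_le hab] at hu
    exact ((hf u hu).fun_inv (hf₀ u hu)).fun_neg.congr_deriv (by ring)

end DerivativeOfInverse

section VanDerCorput

variable {h h' h'' : ℝ → ℝ} {a b : ℝ}

/-- The boundary terms come from integrating `(1 / h') * (exp (i h))'` by parts. -/
theorem integral_cexp_mul_I_eq (hab : a ≤ b) (hh : ∀ u ∈ Icc a b, HasDerivAt h (h' u) u)
    (hh' : ∀ u ∈ Icc a b, HasDerivAt h' (h'' u) u) (hpos : ∀ u ∈ Icc a b, 0 ≤ h'' u)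
    (hne : ∀ u ∈ Icc a b, h' u ≠ 0) :
    (∫ u in a..b, Complex.exp (h u * Complex.I)) * Complex.I =
      ((h' b)⁻¹ : ℝ) * Complex.exp (h b * Complex.I) -
        ((h' a)⁻¹ : ℝ) * Complex.exp (h a * Complex.I) +
        ∫ u in a..b, ((h'' u / h' u ^ 2 : ℝ) : ℂ) * Complex.exp (h u * Complex.I) := by
  have hasDeriv_inv (u) (hu : u ∈ uIcc a b) :
      HasDerivAt (fun u => (((h' u)⁻¹ : ℝ) : ℂ)) ((-(h'' u / h' u ^ 2) : ℝ) : ℂ) u := by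
    rw [uIcc_of_le hab] at hu
    exact ((hh' u hu).fun_inv (hne u hu)).ofReal_comp.congr_deriv (by rw [neg_div])
  have hasDeriv_exp (u) (hu : u ∈ uIcc a b) : HasDerivAt (fun u => Complex.exp (h u * Complex.I))
      (Complex.exp (h u * Complex.I) * (h' u * Complex.I)) u :=
    ((hh u (uIcc_of_le hab ▸ hu)).ofReal_comp.mul_const Complex.I).cexp
  have continuousOn_exp : ContinuousOn
      (fun u => Complex.exp (h u * Complex.I) * (h' u * Complex.I)) (uIcc a b) := by
    have hc : ContinuousOn h (uIcc a b) := fun u hu =>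
      (hh u (uIcc_of_le hab ▸ hu)).continuousAt.continuousWithinAt
    have hc' : ContinuousOn h' (uIcc a b) := fun u hu =>
      (hh' u (uIcc_of_le hab ▸ hu)).continuousAt.continuousWithinAt
    fun_prop
  have integrable_deriv_inv :
      IntervalIntegrable (fun u => ((-(h'' u / h' u ^ 2) : ℝ) : ℂ)) volume a b :=
    have := intervalIntegrable_deriv_div_sq hab hh' hne hpos
    ⟨this.1.neg.ofReal, this.2.neg.ofReal⟩
  have parts := intervalIntegral.integral_mul_deriv_eq_deriv_mul hasDeriv_inv hasDeriv_exp
    integrable_deriv_inv continuousOn_exp.intervalIntegrable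
  simp only [Complex.ofReal_neg, neg_mul, intervalIntegral.integral_neg, sub_neg_eq_add] at parts
  rw [← parts, ← intervalIntegral.integral_mul_const]
  refine intervalIntegral.integral_congr fun u hu => ?_
  have : (h' u : ℂ) ≠ 0 := Complex.ofReal_ne_zero.2 (hne u (uIcc_of_le hab ▸ hu))
  push_cast
  field_simp

theorem norm_integral_cexp_le_of_le_abs_deriv {m : ℝ} (hm : 0 < m) (hab : a ≤ b)
    (hh : ∀ u ∈ Icc a b, HasDerivAt h (h' u) u) (hh' : ∀ u ∈ Icc a b, HasDerivAt h' (h'' u) u)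
    (hpos : ∀ u ∈ Icc a b, 0 ≤ h'' u) (hle : ∀ u ∈ Icc a b, m ≤ |h' u|) :
    ‖∫ u in a..b, Complex.exp (h u * Complex.I)‖ ≤ 4 / m := by
  have hne (u) (hu : u ∈ Icc a b) : h' u ≠ 0 := abs_pos.1 (hm.trans_le (hle u hu))
  have abs_inv_le (u) (hu : u ∈ Icc a b) : |(h' u)⁻¹| ≤ 1 / m := by
    rw [abs_inv, one_div]
    exact inv_anti₀ hm (hle u hu)
  have boundary_le (u) (hu : u ∈ Icc a b) :
      ‖((h' u)⁻¹ : ℝ) * Complex.exp (h u * Complex.I)‖ ≤ 1 / m := by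
    rw [norm_mul, Complex.norm_exp_ofReal_mul_I, mul_one, Complex.norm_real]
    exact abs_inv_le u hu
  have remainder_le : ‖∫ u in a..b, ((h'' u / h' u ^ 2 : ℝ) : ℂ) * Complex.exp (h u * Complex.I)‖ ≤
      (h' a)⁻¹ - (h' b)⁻¹ := by
    rw [← integral_deriv_div_sq hab hh' hne hpos]
    refine intervalIntegral.norm_integral_le_of_norm_le hab (ae_of_all _ fun u hu => ?_)
      (intervalIntegrable_deriv_div_sq hab hh' hne hpos)
    rw [norm_mul, Complex.norm_exp_ofReal_mul_I, mul_one, Complex.norm_real,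
      Real.norm_of_nonneg (div_nonneg (hpos u (Ioc_subset_Icc_self hu)) (sq_nonneg _))]
  have ha := left_mem_Icc.2 hab
  have hb := right_mem_Icc.2 hab
  calc ‖∫ u in a..b, Complex.exp (h u * Complex.I)‖
      = ‖(∫ u in a..b, Complex.exp (h u * Complex.I)) * Complex.I‖ := by simp
    _ ≤ 1 / m + 1 / m + ((h' a)⁻¹ - (h' b)⁻¹) := by
        rw [integral_cexp_mul_I_eq hab hh hh' hpos hne]
        exact norm_add_le_of_le (norm_sub_le_of_le (boundary_le b hb) (boundary_le a ha))
          remainder_le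
    _ ≤ 1 / m + 1 / m + (1 / m + 1 / m) := by
        have := (abs_le.1 (abs_inv_le a ha)).2
        have := (abs_le.1 (abs_inv_le b hb)).1
        gcongr
        linarith
    _ = 4 / m := by ring

theorem exists_mul_abs_sub_le_abs {f : ℝ → ℝ} {l : ℝ} (hab : a ≤ b)
    (hf : ContinuousOn f (Icc a b))
    (hgrow : ∀ x ∈ Icc a b, ∀ y ∈ Icc a b, x ≤ y → l * (y - x) ≤ f y - f x) :
    ∃ c ∈ Icc a b, ∀ u ∈ Icc a b, l * |u - c| ≤ |f u| := by
  have ha := left_mem_Icc.2 hab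
  have hb := right_mem_Icc.2 hab
  rcases le_total 0 (f a) with hfa | hfa
  · refine ⟨a, ha, fun u hu => ?_⟩
    rw [abs_of_nonneg (sub_nonneg.2 hu.1)]
    linarith [hgrow a ha u hu hu.1, le_abs_self (f u)]
  rcases le_total (f b) 0 with hfb | hfb
  · refine ⟨b, hb, fun u hu => ?_⟩
    rw [abs_of_nonpos (sub_nonpos.2 hu.2), neg_sub]
    linarith [hgrow u hu b hb hu.2, neg_abs_le (f u)]
  obtain ⟨c, hc, hfc⟩ := intermediate_value_Icc hab hf ⟨hfa, hfb⟩
  refine ⟨c, hc, fun u hu => ?_⟩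
  rcases le_total c u with hcu | huc
  · rw [abs_of_nonneg (sub_nonneg.2 hcu)]
    linarith [hgrow c hc u hu hcu, le_abs_self (f u)]
  · rw [abs_of_nonpos (sub_nonpos.2 huc), neg_sub]
    linarith [hgrow u hu c hc huc, neg_abs_le (f u)]

theorem norm_intervalIntegral_le_add_add {E : Type*} [NormedAddCommGroup E] [NormedSpace ℝ E]
    {f : ℝ → E} {a b c d : ℝ} (hf : IntervalIntegrable f volume a d) (hb : b ∈ uIcc a d)
    (hc : c ∈ uIcc a d) :
    ‖∫ u in a..d, f u‖ ≤ ‖∫ u in a..b, f u‖ + ‖∫ u in b..c, f u‖ + ‖∫ u in c..d, f u‖ := by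
  have hab := hf.mono_set (uIcc_subset_uIcc_left hb)
  have hac := hf.mono_set (uIcc_subset_uIcc_left hc)
  have hcd := hf.mono_set (uIcc_subset_uIcc_right hc)
  rw [← intervalIntegral.integral_add_adjacent_intervals hac hcd,
    ← intervalIntegral.integral_add_adjacent_intervals hab (hab.symm.trans hac)]
  exact norm_add₃_le

theorem norm_integral_cexp_mul_I_le (h : ℝ → ℝ) (hab : a ≤ b) :
    ‖∫ u in a..b, Complex.exp (h u * Complex.I)‖ ≤ b - a := by
  simpa only [one_mul, abs_of_nonneg (sub_nonneg.2 hab)] using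
    intervalIntegral.norm_integral_le_of_norm_le_const (a := a) (b := b)
      fun u _ => (Complex.norm_exp_ofReal_mul_I (h u)).le

/-- The first derivative test is applied outside `(c - δ, c + δ)`. -/
theorem norm_integral_cexp_le_of_mul_abs_sub_le {c l δ : ℝ} (hl : 0 < l) (hδ : 0 < δ)
    (hc : c ∈ Icc a b) (hh : ∀ u ∈ Icc a b, HasDerivAt h (h' u) u)
    (hh' : ∀ u ∈ Icc a b, HasDerivAt h' (h'' u) u) (hpos : ∀ u ∈ Icc a b, 0 ≤ h'' u)
    (hfar : ∀ u ∈ Icc a b, l * |u - c| ≤ |h' u|) :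
    ‖∫ u in a..b, Complex.exp (h u * Complex.I)‖ ≤ 2 * δ + 8 / (l * δ) := by
  have hab : a ≤ b := hc.1.trans hc.2
  have outer_le {x y : ℝ} (hxy : x ≤ y) (hsub : Icc x y ⊆ Icc a b)
      (hdist : ∀ u ∈ Icc x y, δ ≤ |u - c|) :
      ‖∫ u in x..y, Complex.exp (h u * Complex.I)‖ ≤ 4 / (l * δ) :=
    norm_integral_cexp_le_of_le_abs_deriv (by positivity) hxy (fun u hu => hh u (hsub hu))
      (fun u hu => hh' u (hsub hu)) (fun u hu => hpos u (hsub hu)) fun u hu =>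
        (mul_le_mul_of_nonneg_left (hdist u hu) hl.le).trans (hfar u (hsub hu))
  have left_le : ‖∫ u in a..max a (c - δ), Complex.exp (h u * Complex.I)‖ ≤ 4 / (l * δ) := by
    rcases le_total (c - δ) a with hca | hac
    · rw [max_eq_left hca, intervalIntegral.integral_same, norm_zero]
      positivity
    · rw [max_eq_right hac]
      refine outer_le hac (Icc_subset_Icc_right (by linarith [hc.2])) fun u hu => ?_
      exact le_abs.2 (.inr (by linarith [hu.2]))
  have right_le : ‖∫ u in min b (c + δ)..b, Complex.exp (h u * Complex.I)‖ ≤ 4 / (l * δ) := by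
    rcases le_total b (c + δ) with hbc | hcb
    · rw [min_eq_left hbc, intervalIntegral.integral_same, norm_zero]
      positivity
    · rw [min_eq_right hcb]
      refine outer_le hcb (Icc_subset_Icc_left (by linarith [hc.1])) fun u hu => ?_
      exact le_abs.2 (.inl (by linarith [hu.1]))
  have hleft : max a (c - δ) ≤ c := max_le hc.1 (by linarith)
  have hright : c ≤ min b (c + δ) := le_min hc.2 (by linarith)
  have middle_le := norm_integral_cexp_mul_I_le h (hleft.trans hright)
  have integrable : IntervalIntegrable (fun u => Complex.exp (h u * Complex.I)) volume a b := by
    have : ContinuousOn h (uIcc a b) := fun u hu =>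
      (hh u (uIcc_of_le hab ▸ hu)).continuousAt.continuousWithinAt
    exact ContinuousOn.intervalIntegrable (by fun_prop)
  have split := norm_intervalIntegral_le_add_add integrable
    (Icc_subset_uIcc ⟨le_max_left a (c - δ), hleft.trans hc.2⟩)
    (Icc_subset_uIcc ⟨hc.1.trans hright, min_le_left b (c + δ)⟩)
  have : 4 / (l * δ) + 4 / (l * δ) = 8 / (l * δ) := by ring
  linarith [le_max_right a (c - δ), min_le_right b (c + δ)]

theorem norm_integral_cexp_le_of_le_deriv2 {l : ℝ} (hl : 0 < l) (hab : a ≤ b)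
    (hh : ∀ u ∈ Icc a b, HasDerivAt h (h' u) u) (hh' : ∀ u ∈ Icc a b, HasDerivAt h' (h'' u) u)
    (hle : ∀ u ∈ Icc a b, l ≤ h'' u) :
    ‖∫ u in a..b, Complex.exp (h u * Complex.I)‖ ≤ 8 / √l := by
  have continuousOn_deriv : ContinuousOn h' (Icc a b) := fun u hu =>
    (hh' u hu).continuousAt.continuousWithinAt
  obtain ⟨c, hc, hfar⟩ := exists_mul_abs_sub_le_abs hab continuousOn_deriv
    ((convex_Icc a b).mul_sub_le_image_sub_of_le_deriv continuousOn_deriv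
      (fun u hu => (hh' u (interior_subset hu)).differentiableAt.differentiableWithinAt)
      fun u hu => (hle u (interior_subset hu)).trans_eq (hh' u (interior_subset hu)).deriv.symm)
  refine (norm_integral_cexp_le_of_mul_abs_sub_le hl (δ := 2 / √l) (by positivity) hc hh hh'
    (fun u hu => hl.le.trans (hle u hu)) hfar).trans_eq ?_
  field_simp
  rw [Real.sq_sqrt hl.le]
  ring

theorem norm_integral_cexp_neg (h : ℝ → ℝ) (a b : ℝ) :
    ‖∫ u in a..b, Complex.exp ((-h u : ℝ) * Complex.I)‖ =
      ‖∫ u in a..b, Complex.exp (h u * Complex.I)‖ := by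
  rw [← RCLike.norm_conj]
  simp only [intervalIntegral, map_sub, ← integral_conj, ← Complex.exp_conj, map_mul,
    map_neg, Complex.conj_ofReal, Complex.conj_I, Complex.ofReal_neg, neg_mul_neg]

end VanDerCorput

section TollPhase

variable {α K B u : ℝ}

/-- The phase of the oscillatory integrals attached to the bivariate toll. The entropy term is
`K (u log u + (1 - u) log (1 - u))`, written with Mathlib's binary entropy, which has the opposite
sign. -/
noncomputable def tollPhase (α K B u : ℝ) : ℝ :=
  α * u - K * Real.binEntropy u + B * (u * (1 - u))

theorem tollPhase_neg (α K B u : ℝ) : tollPhase (-α) (-K) (-B) u = -tollPhase α K B u := by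
  unfold tollPhase
  ring

theorem continuous_tollPhase (α K B : ℝ) : Continuous (tollPhase α K B) := by
  unfold tollPhase
  fun_prop

theorem hasDerivAt_tollPhase (α K B : ℝ) (h₀ : u ≠ 0) (h₁ : u ≠ 1) :
    HasDerivAt (tollPhase α K B)
      (α + K * (Real.log u - Real.log (1 - u)) + B * (1 - 2 * u)) u := by
  have quadratic : HasDerivAt (fun u : ℝ => u * (1 - u)) (1 - 2 * u) u :=
    ((hasDerivAt_id' u).fun_mul ((hasDerivAt_id' u).const_sub 1)).congr_deriv (by ring)
  exact ((((hasDerivAt_id' u).const_mul α).fun_sub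
    ((Real.hasDerivAt_binEntropy h₀ h₁).const_mul K)).fun_add (quadratic.const_mul B)).congr_deriv
    (by ring)

theorem hasDerivAt_deriv_tollPhase (α K B : ℝ) (h₀ : u ≠ 0) (h₁ : u ≠ 1) :
    HasDerivAt (fun u => α + K * (Real.log u - Real.log (1 - u)) + B * (1 - 2 * u))
      (K / (u * (1 - u)) - 2 * B) u := by
  have h₁' : 1 - u ≠ 0 := sub_ne_zero.2 h₁.symm
  have logit : HasDerivAt (fun u => Real.log u - Real.log (1 - u)) (1 / (u * (1 - u))) u := by
    refine ((Real.hasDerivAt_log h₀).fun_sub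
      (((hasDerivAt_id' u).const_sub 1).log h₁')).congr_deriv ?_
    field_simp
    ring
  refine (((logit.const_mul K).const_add α).fun_add
    ((((hasDerivAt_id' u).const_mul 2).const_sub 1).const_mul B)).congr_deriv ?_
  ring

theorem le_div_mul_one_sub_sub {M : ℝ} (hM : 0 ≤ M) (h₀ : 0 < u) (h₁ : u < 1)
    (h : M ≤ K - 2 * B * (u * (1 - u))) : 4 * M ≤ K / (u * (1 - u)) - 2 * B := by
  have hs : 0 < u * (1 - u) := mul_pos h₀ (sub_pos.2 h₁)
  have hs4 : u * (1 - u) ≤ 1 / 4 := by nlinarith [sq_nonneg (u - 1 / 2)]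
  rw [le_sub_iff_add_le, le_div_iff₀ hs]
  nlinarith

/-- The second derivative of `tollPhase` has a single sign change in `u (1 - u)`. On
`[1/16, 1/8]` one has `u (1 - u) ≤ 11/100`, on `[1/4, 5/16]` one has `18/100 ≤ u (1 - u)`, and the
intermediate value `29/200` decides which of the two intervals to take. -/
theorem exists_interval_le_deriv2_tollPhase (h : 0 ≤ K - 2 * B * (29 / 200)) :
    ∃ a b : ℝ, b - a = 1 / 16 ∧ Icc a b ⊆ Icc (1 / 16) (5 / 16) ∧
      ∀ u ∈ Icc a b, (|K| + |B|) / 5 ≤ K / (u * (1 - u)) - 2 * B := by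
  suffices ∃ a b : ℝ, b - a = 1 / 16 ∧ Icc a b ⊆ Icc (1 / 16) (5 / 16) ∧
      ∀ u ∈ Icc a b, (|K| + |B|) / 20 ≤ K - 2 * B * (u * (1 - u)) by
    obtain ⟨a, b, hab, hsub, hle⟩ := this
    refine ⟨a, b, hab, hsub, fun u hu => ?_⟩
    have := le_div_mul_one_sub_sub (by positivity) (by linarith [(hsub hu).1])
      (by linarith [(hsub hu).2]) (hle u hu)
    linarith
  rcases le_total 0 B with hB | hB
  · refine ⟨1 / 16, 1 / 8, by norm_num, Icc_subset_Icc_right (by norm_num), fun u hu => ?_⟩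
    have hs : u * (1 - u) ≤ 11 / 100 := by nlinarith [hu.1, hu.2]
    rw [abs_of_nonneg hB, abs_of_nonneg (by linarith)]
    nlinarith
  · refine ⟨1 / 4, 5 / 16, by norm_num, Icc_subset_Icc_left (by norm_num), fun u hu => ?_⟩
    have hs : 18 / 100 ≤ u * (1 - u) := by nlinarith [hu.1, hu.2]
    have hK : |K| ≤ K - 2 * B * (29 / 200) - 29 / 100 * B :=
      abs_le.2 ⟨by linarith, by linarith⟩
    rw [abs_of_nonpos hB]
    nlinarith

theorem abs_log_sub_log_one_sub_le (hu : u ∈ Icc (1 / 16 : ℝ) (5 / 16)) :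
    |Real.log u - Real.log (1 - u)| ≤ 15 := by
  have inv_le : u⁻¹ ≤ 16 := inv_le_of_inv_le₀ (by norm_num) (by linarith [hu.1])
  have log_le : Real.log u ≤ Real.log (1 - u) :=
    Real.log_le_log (by linarith [hu.1]) (by linarith [hu.2])
  have log_one_sub_le : Real.log (1 - u) ≤ 0 :=
    Real.log_nonpos (by linarith [hu.2]) (by linarith [hu.1])
  rw [abs_of_nonpos (sub_nonpos.2 log_le)]
  linarith [Real.one_sub_inv_le_log_of_pos (show 0 < u by linarith [hu.1])]

theorem le_abs_deriv_tollPhase {m : ℝ} (hu : u ∈ Icc (1 / 16 : ℝ) (5 / 16))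
    (h : m + 15 * (|K| + |B|) ≤ |α|) :
    m ≤ |α + K * (Real.log u - Real.log (1 - u)) + B * (1 - 2 * u)| := by
  have log_part : |K * (Real.log u - Real.log (1 - u))| ≤ |K| * 15 := by
    rw [abs_mul]
    exact mul_le_mul_of_nonneg_left (abs_log_sub_log_one_sub_le hu) (abs_nonneg K)
  have linear_part : |B * (1 - 2 * u)| ≤ |B| * 15 := by
    rw [abs_mul]
    refine mul_le_mul_of_nonneg_left (abs_le.2 ⟨?_, ?_⟩) (abs_nonneg B) <;> linarith [hu.1, hu.2]
  have := abs_sub_abs_le_abs_sub α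
    (-(K * (Real.log u - Real.log (1 - u)) + B * (1 - 2 * u)))
  rw [abs_neg, sub_neg_eq_add, ← add_assoc] at this
  linarith [abs_add_le (K * (Real.log u - Real.log (1 - u))) (B * (1 - 2 * u))]

/-- The second derivative test covers large `K` or `B`, the first derivative test the remaining
case of a dominating linear coefficient `α`. -/
theorem norm_integral_cexp_tollPhase_le
    (h : 327680 ≤ |K| + |B| ∨ 128 + 15 * (|K| + |B|) ≤ |α|) :
    ‖∫ u in (0 : ℝ)..1, Complex.exp (tollPhase α K B u * Complex.I)‖ ≤ 31 / 32 := by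
  wlog hsign : 0 ≤ K - 2 * B * (29 / 200) generalizing α K B
  · have := this (α := -α) (K := -K) (B := -B) (by simpa only [abs_neg]) (by linarith)
    simpa only [tollPhase_neg, norm_integral_cexp_neg] using this
  obtain ⟨a, b, hab, hsub, hle⟩ := exists_interval_le_deriv2_tollPhase hsign
  have hbounds := (Icc_subset_Icc_iff (by linarith)).1 hsub
  have hd (u) (hu : u ∈ Icc a b) := hasDerivAt_tollPhase (u := u) α K B
    (ne_of_gt (by linarith [(hsub hu).1])) (ne_of_lt (by linarith [(hsub hu).2]))
  have hd' (u) (hu : u ∈ Icc a b) := hasDerivAt_deriv_tollPhase (u := u) α K B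
    (ne_of_gt (by linarith [(hsub hu).1])) (ne_of_lt (by linarith [(hsub hu).2]))
  have oscillating_le : ‖∫ u in a..b, Complex.exp (tollPhase α K B u * Complex.I)‖ ≤ 1 / 32 := by
    rcases h with h | h
    · refine (norm_integral_cexp_le_of_le_deriv2 (l := 65536) (by norm_num) (by linarith) hd hd'
        fun u hu => by linarith [hle u hu]).trans_eq ?_
      rw [show (65536 : ℝ) = 256 ^ 2 by norm_num, Real.sqrt_sq (by norm_num)]
      norm_num
    · refine (norm_integral_cexp_le_of_le_abs_deriv (m := 128) (by norm_num) (by linarith) hd hd'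
        (fun u hu => le_trans (by positivity) (hle u hu))
        fun u hu => le_abs_deriv_tollPhase (hsub hu) h).trans_eq ?_
      norm_num
  have integrable : IntervalIntegrable
      (fun u => Complex.exp (tollPhase α K B u * Complex.I)) volume 0 1 := by
    have := continuous_tollPhase α K B
    exact Continuous.intervalIntegrable (by fun_prop) _ _
  have split := norm_intervalIntegral_le_add_add integrable (b := a) (c := b)
    (Icc_subset_uIcc ⟨by linarith, by linarith⟩) (Icc_subset_uIcc ⟨by linarith, by linarith⟩)
  have left_le := norm_integral_cexp_mul_I_le (tollPhase α K B) (show 0 ≤ a by linarith)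
  have right_le := norm_integral_cexp_mul_I_le (tollPhase α K B) (show b ≤ 1 by linarith)
  linarith

theorem eventually_norm_integral_cexp_tollPhase_le :
    ∀ᶠ p : ℝ × ℝ × ℝ in Bornology.cobounded _,
      ‖∫ u in (0 : ℝ)..1, Complex.exp (tollPhase p.1 p.2.1 p.2.2 u * Complex.I)‖ ≤ 31 / 32 := by
  filter_upwards [eventually_cobounded_le_norm (128 + 15 * 327680)] with ⟨α, K, B⟩ hp
  refine norm_integral_cexp_tollPhase_le ?_
  by_contra! hsmall
  have hK := abs_nonneg K
  have hB := abs_nonneg B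
  simp only [Prod.norm_mk, Real.norm_eq_abs, le_max_iff] at hp
  rcases hp with hp | hp | hp <;> linarith

end TollPhase

end OscillatoryIntegrals

section Subsolutions

open Bornology Filter Set

/-- The properties of the modulus `φ = ‖charFun μ ·‖` of the characteristic function of a solution
of a Quicksort equation that force rapid decay. The toll function only contributes a phase and does
not enter. -/
structure IsQuicksortSubsolution {V : Type*} [NormedAddCommGroup V] [NormedSpace ℝ V]
    (φ : V → ℝ) : Prop where
  continuous : Continuous φ
  nonneg (ξ : V) : 0 ≤ φ ξ
  le_one (ξ : V) : φ ξ ≤ 1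
  le_integral (ξ : V) : φ ξ ≤ ∫ u in (0 : ℝ)..1, φ (u • ξ) * φ ((1 - u) • ξ)

namespace IsQuicksortSubsolution

variable {V : Type*} [NormedAddCommGroup V] [NormedSpace ℝ V] {φ : V → ℝ} {ξ : V}

theorem intervalIntegrable (h : IsQuicksortSubsolution φ) (ξ : V) (a b : ℝ) :
    IntervalIntegrable (fun u : ℝ => φ (u • ξ) * φ ((1 - u) • ξ)) volume a b := by
  have := h.continuous
  exact Continuous.intervalIntegrable (by fun_prop) a b

theorem le_two_mul_integral_half (h : IsQuicksortSubsolution φ) (ξ : V) :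
    φ ξ ≤ 2 * ∫ u in (0 : ℝ)..(1 / 2), φ (u • ξ) * φ ((1 - u) • ξ) := by
  have symmetric : ∫ u in (0 : ℝ)..(1 / 2), φ (u • ξ) * φ ((1 - u) • ξ) =
      ∫ u in (1 / 2 : ℝ)..1, φ (u • ξ) * φ ((1 - u) • ξ) := by
    have := intervalIntegral.integral_comp_sub_left (a := 0) (b := 1 / 2)
      (fun u : ℝ => φ (u • ξ) * φ ((1 - u) • ξ)) 1
    simp only [sub_sub_cancel, sub_zero, sub_half] at this
    simpa only [mul_comm] using this
  have := intervalIntegral.integral_add_adjacent_intervals (h.intervalIntegrable ξ 0 (1 / 2))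
    (h.intervalIntegrable ξ (1 / 2) 1)
  linarith [h.le_integral ξ]

theorem integral_le_mul (h : IsQuicksortSubsolution φ) {a b p q : ℝ} (hab : a ≤ b)
    (hb : b ≤ 1 / 2) (hp : 0 ≤ p) (hφp : ∀ u ∈ Icc a b, φ (u • ξ) ≤ p)
    (hφq : ∀ ζ, ‖ξ‖ / 2 ≤ ‖ζ‖ → φ ζ ≤ q) :
    ∫ u in a..b, φ (u • ξ) * φ ((1 - u) • ξ) ≤ (b - a) * (p * q) := by
  rw [← smul_eq_mul (b - a), ← intervalIntegral.integral_const]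
  refine intervalIntegral.integral_mono_on hab (h.intervalIntegrable ξ a b)
    intervalIntegrable_const fun u hu => ?_
  refine mul_le_mul (hφp u hu) (hφq _ ?_) (h.nonneg _) hp
  have : u ≤ 1 / 2 := hu.2.trans hb
  rw [norm_smul, Real.norm_of_nonneg (by linarith)]
  nlinarith [norm_nonneg ξ]

/-- By symmetry only `u ≤ 1/2` matters, where the factor `φ ((1 - u) • ξ)` is at most `q`; the
factor `φ (u • ξ)` is at most `1` for `u ≤ R / ‖ξ‖` and at most `η` beyond. -/
theorem le_mul_add (h : IsQuicksortSubsolution φ) {η R q : ℝ} (hη : 0 ≤ η) (hR : 0 < R)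
    (hφη : ∀ ζ, R ≤ ‖ζ‖ → φ ζ ≤ η) (hξ : 2 * R ≤ ‖ξ‖) (hφq : ∀ ζ, ‖ξ‖ / 2 ≤ ‖ζ‖ → φ ζ ≤ q) :
    φ ξ ≤ q * (η + 2 * (R / ‖ξ‖)) := by
  have hξ₀ : 0 < ‖ξ‖ := by linarith
  have hq : 0 ≤ q := (h.nonneg ξ).trans (hφq ξ (half_le_self (norm_nonneg ξ)))
  set d := R / ‖ξ‖ with hd
  have hd₀ : 0 < d := by positivity
  have hd_half : d ≤ 1 / 2 := by rw [hd, div_le_div_iff₀ hξ₀ two_pos]; linarith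
  have near_zero := h.integral_le_mul hd₀.le hd_half zero_le_one (fun u _ => h.le_one (u • ξ)) hφq
  have away_from_zero := h.integral_le_mul hd_half le_rfl hη (fun u hu => hφη (u • ξ) <| by
    rw [norm_smul, Real.norm_of_nonneg (hd₀.le.trans hu.1)]
    exact (div_le_iff₀ hξ₀).1 hu.1) hφq
  have half := h.le_two_mul_integral_half ξ
  rw [← intervalIntegral.integral_add_adjacent_intervals (h.intervalIntegrable ξ 0 d)
    (h.intervalIntegrable ξ d (1 / 2))] at half
  have : 0 ≤ η * q * d := by positivity
  linarith

theorem exists_le_pow (h : IsQuicksortSubsolution φ) {η η' : ℝ} (hη : 0 ≤ η) (hηη' : η < η')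
    (hφη : ∀ᶠ ξ in cobounded V, φ ξ ≤ η) :
    ∃ R > 0, ∀ (n : ℕ) (ξ : V), 2 ^ n * R ≤ ‖ξ‖ → φ ξ ≤ η' ^ n := by
  obtain ⟨R₀, -, hR₀⟩ := hasBasis_cobounded_norm.eventually_iff.1 hφη
  set R := max R₀ 1
  have hR : 0 < R := lt_max_of_lt_right one_pos
  have hφR (ζ : V) (hζ : R ≤ ‖ζ‖) : φ ζ ≤ η := hR₀ ((le_max_left _ _).trans hζ)
  have hs : 0 < η' - η := sub_pos.2 hηη'
  set M := max (2 * R) (2 * R / (η' - η))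
  have hM : 0 < M := lt_max_of_lt_left (by positivity)
  refine ⟨M, hM, fun n => ?_⟩
  induction n with
  | zero => simpa using fun ξ _ => h.le_one ξ
  | succ n ih =>
    intro ξ hξ
    have hMξ : M ≤ ‖ξ‖ := (le_mul_of_one_le_left hM.le (one_le_pow₀ one_le_two)).trans hξ
    have step := h.le_mul_add hη hR hφR ((le_max_left _ _).trans hMξ) fun ζ hζ => ih ζ (by
      rw [pow_succ] at hξ
      linarith)
    have gain : 2 * (R / ‖ξ‖) ≤ η' - η := by
      rw [← mul_div_assoc, div_le_iff₀ (hM.trans_le hMξ), ← div_le_iff₀' hs]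
      exact (le_max_right _ _).trans hMξ
    rw [pow_succ]
    exact step.trans (mul_le_mul_of_nonneg_left (by linarith) (pow_nonneg (by linarith) n))

theorem eventually_le (h : IsQuicksortSubsolution φ) {η ε : ℝ} (hη : η < 1)
    (hφη : ∀ᶠ ξ in cobounded V, φ ξ ≤ η) (hε : 0 < ε) : ∀ᶠ ξ in cobounded V, φ ξ ≤ ε := by
  obtain ⟨η', hη', hη'_lt⟩ := exists_between (max_lt hη one_pos)
  obtain ⟨R, -, hR⟩ := h.exists_le_pow (le_max_right η 0) hη'
    (hφη.mono fun ξ hξ => hξ.trans (le_max_left η 0))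
  obtain ⟨n, hn⟩ := exists_pow_lt_of_lt_one hε hη'_lt
  filter_upwards [eventually_cobounded_le_norm (2 ^ n * R)] with ξ hξ
  exact (hR n ξ hξ).trans hn.le

/-- Once `φ` is below `2 ^ (-k - 1)` near infinity, doubling `‖ξ‖` gains a factor `2 ^ (-k)`. -/
theorem exists_pow_mul_le (h : IsQuicksortSubsolution φ) {η : ℝ} (hη : η < 1)
    (hφη : ∀ᶠ ξ in cobounded V, φ ξ ≤ η) (k : ℕ) : ∃ C : ℝ, ∀ ξ, ‖ξ‖ ^ k * φ ξ ≤ C := by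
  obtain ⟨R, hR, hφR⟩ := h.exists_le_pow (η := (1 / 2) ^ (k + 1)) (η' := (1 / 2) ^ k)
    (by positivity)
    (pow_lt_pow_right_of_lt_one₀ (by norm_num) (by norm_num) (Nat.lt_succ_self k))
    (h.eventually_le hη hφη (by positivity))
  refine ⟨(2 * R) ^ k, fun ξ => ?_⟩
  rcases lt_or_ge ‖ξ‖ R with hξ | hξ
  · calc ‖ξ‖ ^ k * φ ξ ≤ (2 * R) ^ k * 1 :=
        mul_le_mul (by gcongr; linarith) (h.le_one ξ) (h.nonneg ξ) (by positivity)
      _ = (2 * R) ^ k := mul_one _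
  · obtain ⟨m, hm, hm'⟩ := exists_nat_pow_near ((one_le_div hR).2 hξ) (one_lt_two (α := ℝ))
    rw [le_div_iff₀ hR] at hm
    rw [div_lt_iff₀ hR] at hm'
    calc ‖ξ‖ ^ k * φ ξ ≤ (2 ^ (m + 1) * R) ^ k * ((1 / 2) ^ k) ^ m :=
        mul_le_mul (by gcongr) (hφR m ξ hm) (h.nonneg ξ) (by positivity)
      _ = (2 * R) ^ k * (2 ^ m * (1 / 2) ^ m) ^ k := by ring
      _ = (2 * R) ^ k := by rw [← mul_pow 2 (1 / 2 : ℝ) m]; norm_num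

end IsQuicksortSubsolution

end Subsolutions

section QuicksortLaws

open Bornology Filter Set Topology
open scoped RealInnerProductSpace

theorem exists_lt_one_eventually_integral_le {X ι : Type*} [MeasurableSpace X] {μ : Measure X}
    [IsProbabilityMeasure μ] {l : Filter ι} [l.IsCountablyGenerated] {G : ι → X → ℝ} {S : Set X}
    {θ : ℝ} (hG : ∀ i, Measurable (G i)) (hG₀ : ∀ i x, 0 ≤ G i x) (hG₁ : ∀ i x, G i x ≤ 1)
    (hS : MeasurableSet S) (hμS : μ S ≠ 0) (hθ : θ < 1)
    (hGθ : ∀ x ∈ S, ∀ᶠ i in l, G i x ≤ θ) :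
    ∃ η < 1, ∀ᶠ i in l, ∫ x, G i x ∂μ ≤ η := by
  set b : X → ℝ := fun x => 1 - S.indicator (fun _ => 1 - θ) x with hb
  have measurable_b : Measurable b := measurable_const.sub (measurable_const.indicator hS)
  have b_le_one (x : X) : b x ≤ 1 := sub_le_self _ (indicator_nonneg (fun _ _ => by linarith) x)
  have integral_b_lt : ∫ x, b x ∂μ < 1 := by
    rw [hb, integral_sub (integrable_const _) ((integrable_const _).indicator hS),
      integral_indicator_const _ hS, integral_const, probReal_univ, one_smul]
    exact sub_lt_self _ (mul_pos (ENNReal.toReal_pos hμS (measure_ne_top μ S)) (by linarith))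
  have max_eq (x : X) : ∀ᶠ i in l, max (G i x) (b x) = b x := by
    by_cases hx : x ∈ S
    · filter_upwards [hGθ x hx] with i hi
      exact max_eq_right (by simpa only [hb, indicator_of_mem hx, sub_sub_cancel] using hi)
    · exact Eventually.of_forall fun i => max_eq_right <| by
        simpa only [hb, indicator_of_notMem hx, sub_zero] using hG₁ i x
  have norm_max_le (i : ι) (x : X) : ‖max (G i x) (b x)‖ ≤ 1 := by
    rw [Real.norm_of_nonneg ((hG₀ i x).trans (le_max_left _ _))]
    exact max_le (hG₁ i x) (b_le_one x)
  have aestronglyMeasurable_max (i : ι) : AEStronglyMeasurable (fun x => max (G i x) (b x)) μ :=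
    ((hG i).max measurable_b).aestronglyMeasurable
  have tendsto_integral : Tendsto (fun i => ∫ x, max (G i x) (b x) ∂μ) l (𝓝 (∫ x, b x ∂μ)) :=
    tendsto_integral_filter_of_dominated_convergence (fun _ => 1)
      (Eventually.of_forall aestronglyMeasurable_max)
      (Eventually.of_forall fun i => ae_of_all _ (norm_max_le i)) (integrable_const 1)
      (ae_of_all _ fun x => tendsto_const_nhds.congr' ((max_eq x).mono fun i hi => hi.symm))
  obtain ⟨η, hη, hη_lt⟩ := exists_between integral_b_lt
  refine ⟨η, hη_lt, ?_⟩
  filter_upwards [tendsto_integral.eventually_le_const hη] with i hi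
  exact (integral_mono_of_nonneg (ae_of_all _ (hG₀ i))
    (.of_bound (aestronglyMeasurable_max i) 1 (ae_of_all _ (norm_max_le i)))
    (ae_of_all _ fun x => le_max_left _ _)).trans hi

variable {V : Type*} [NormedAddCommGroup V] [InnerProductSpace ℝ V]

/-- The right-hand side of the Quicksort equation with toll function `g`, as a function of
`((z₁, z₂), u)`. -/
def quicksortMap (g : ℝ → V) (p : (V × V) × ℝ) : V :=
  p.2 • p.1.1 + (1 - p.2) • p.1.2 + g p.2

theorem inner_quicksortMap (g : ℝ → V) (z : V × V) (u : ℝ) (ξ : V) :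
    ⟪quicksortMap g (z, u), ξ⟫ = u * ⟪z.1, ξ⟫ + (1 - u) * ⟪z.2, ξ⟫ + ⟪g u, ξ⟫ := by
  simp only [quicksortMap, inner_add_left, real_inner_smul_left]

variable [MeasurableSpace V]

theorem measurable_quicksortMap [BorelSpace V] [SecondCountableTopology V] {g : ℝ → V}
    (hg : Measurable g) : Measurable (quicksortMap g) := by
  unfold quicksortMap
  fun_prop

/-- `μ` is the law of a solution of the Quicksort equation with toll function `g`. The uniform law
is taken on `Ioc 0 1` because interval integrals are. -/
structure IsQuicksortLaw (g : ℝ → V) (μ : Measure V) : Prop where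
  measurable_toll : Measurable g
  map_eq : ((μ.prod μ).prod (volume.restrict (Ioc (0 : ℝ) 1))).map (quicksortMap g) = μ

namespace IsQuicksortLaw

variable [BorelSpace V] [SecondCountableTopology V] {g : ℝ → V} {μ : Measure V}

theorem charFun_eq_integral (h : IsQuicksortLaw g μ) (ξ : V) :
    charFun μ ξ = ∫ p, Complex.exp (⟪quicksortMap g p, ξ⟫ * Complex.I)
      ∂((μ.prod μ).prod (volume.restrict (Ioc (0 : ℝ) 1))) := by
  conv_lhs => rw [← h.map_eq, charFun_apply]
  exact integral_map (measurable_quicksortMap h.measurable_toll).aemeasurable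
    (Measurable.aestronglyMeasurable (by fun_prop))

variable [IsProbabilityMeasure μ]

theorem integrable_cexp_inner_quicksortMap (h : IsQuicksortLaw g μ) (ξ : V) :
    Integrable (fun p => Complex.exp (⟪quicksortMap g p, ξ⟫ * Complex.I))
      ((μ.prod μ).prod (volume.restrict (Ioc (0 : ℝ) 1))) := by
  have := measurable_quicksortMap h.measurable_toll
  exact .of_bound (Measurable.aestronglyMeasurable (by fun_prop)) 1
    (ae_of_all _ fun p => (Complex.norm_exp_ofReal_mul_I _).le)

theorem norm_charFun_le_integral (h : IsQuicksortLaw g μ) (ξ : V) :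
    ‖charFun μ ξ‖ ≤ ∫ z : V × V, ‖∫ u in (0 : ℝ)..1,
      Complex.exp ((u * ⟪z.1 - z.2, ξ⟫ + ⟪g u, ξ⟫ : ℝ) * Complex.I)‖ ∂(μ.prod μ) := by
  rw [h.charFun_eq_integral, integral_prod _ (h.integrable_cexp_inner_quicksortMap ξ)]
  refine (norm_integral_le_integral_norm _).trans_eq ?_
  congr with z
  have factor (u : ℝ) : Complex.exp (⟪quicksortMap g (z, u), ξ⟫ * Complex.I) =
      Complex.exp (⟪z.2, ξ⟫ * Complex.I) *
        Complex.exp ((u * ⟪z.1 - z.2, ξ⟫ + ⟪g u, ξ⟫ : ℝ) * Complex.I) := by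
    rw [inner_quicksortMap, inner_sub_left, ← Complex.exp_add]
    push_cast
    ring_nf
  simp only [factor]
  rw [integral_const_mul, norm_mul, Complex.norm_exp_ofReal_mul_I, one_mul,
    intervalIntegral.integral_of_le zero_le_one]

theorem norm_charFun_le_integral_mul (h : IsQuicksortLaw g μ) (ξ : V) :
    ‖charFun μ ξ‖ ≤ ∫ u in (0 : ℝ)..1, ‖charFun μ (u • ξ)‖ * ‖charFun μ ((1 - u) • ξ)‖ := by
  rw [h.charFun_eq_integral, integral_prod_symm _ (h.integrable_cexp_inner_quicksortMap ξ),
    intervalIntegral.integral_of_le zero_le_one]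
  refine (norm_integral_le_integral_norm _).trans_eq ?_
  congr with u
  have factor (z : V × V) : Complex.exp (⟪quicksortMap g (z, u), ξ⟫ * Complex.I) =
      Complex.exp (⟪g u, ξ⟫ * Complex.I) * (Complex.exp (⟪z.1, u • ξ⟫ * Complex.I) *
        Complex.exp (⟪z.2, (1 - u) • ξ⟫ * Complex.I)) := by
    rw [inner_quicksortMap, inner_smul_right, inner_smul_right, ← Complex.exp_add,
      ← Complex.exp_add]
    push_cast
    ring_nf
  simp only [factor]
  rw [integral_const_mul, norm_mul, Complex.norm_exp_ofReal_mul_I, one_mul,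
    integral_prod_mul (fun z : V => Complex.exp (⟪z, u • ξ⟫ * Complex.I))
      fun z : V => Complex.exp (⟪z, (1 - u) • ξ⟫ * Complex.I), norm_mul]
  simp only [charFun_apply]

theorem isQuicksortSubsolution_norm_charFun (h : IsQuicksortLaw g μ) :
    IsQuicksortSubsolution fun ξ => ‖charFun μ ξ‖ where
  continuous := continuous_charFun.norm
  nonneg _ := norm_nonneg _
  le_one _ := norm_charFun_le_one _
  le_integral := h.norm_charFun_le_integral_mul

/-- If `⟪z, e⟫` is almost surely constant, then the linear part of the equation preserves this
constant, so the toll cannot contribute to it. -/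
theorem ae_inner_toll_eq_zero (h : IsQuicksortLaw g μ) {e : V}
    (he : ∀ᵐ z ∂μ.prod μ, ⟪z.1 - z.2, e⟫ = 0) :
    ∀ᵐ u ∂volume.restrict (Ioc (0 : ℝ) 1), ⟪g u, e⟫ = 0 := by
  obtain ⟨w, hw⟩ := (Measure.ae_ae_of_ae_prod he).exists
  have ae_const : ∀ᵐ z ∂μ, ⟪z, e⟫ = ⟪w, e⟫ := hw.mono fun z hz => by
    rw [inner_sub_left, sub_eq_zero] at hz
    exact hz.symm
  have ae_const_map : ∀ᵐ p ∂(μ.prod μ).prod (volume.restrict (Ioc (0 : ℝ) 1)),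
      ⟪quicksortMap g p, e⟫ = ⟪w, e⟫ :=
    ae_of_ae_map (measurable_quicksortMap h.measurable_toll).aemeasurable (h.map_eq.symm ▸ ae_const)
  obtain ⟨z, hz, hz₁, hz₂⟩ := ((Measure.ae_ae_of_ae_prod ae_const_map).and
    ((Measure.quasiMeasurePreserving_fst.ae ae_const).and
      (Measure.quasiMeasurePreserving_snd.ae ae_const))).exists
  filter_upwards [hz] with u hu
  rw [inner_quicksortMap, hz₁, hz₂] at hu
  linarith

/-- It is enough to have an oscillatory integral estimate on the set of differences `z` with
`⟪z, e⟫ ≠ 0`, since the difference of two independent copies belongs to it with positive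
probability. -/
theorem exists_lt_one_eventually_norm_charFun_le (h : IsQuicksortLaw g μ) {e : V} {θ : ℝ}
    (he : ¬ ∀ᵐ u ∂volume.restrict (Ioc (0 : ℝ) 1), ⟪g u, e⟫ = 0) (hθ : θ < 1)
    (hosc : ∀ z : V, ⟪z, e⟫ ≠ 0 → ∀ᶠ ξ in cobounded V,
      ‖∫ u in (0 : ℝ)..1, Complex.exp ((u * ⟪z, ξ⟫ + ⟪g u, ξ⟫ : ℝ) * Complex.I)‖ ≤ θ) :
    ∃ η < 1, ∀ᶠ ξ in cobounded V, ‖charFun μ ξ‖ ≤ η := by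
  have : (cobounded V).IsCountablyGenerated := by
    rw [← comap_norm_atTop]
    infer_instance
  have := h.measurable_toll
  have measurable_integral (ξ : V) : Measurable fun z : V × V => ‖∫ u in (0 : ℝ)..1,
      Complex.exp ((u * ⟪z.1 - z.2, ξ⟫ + ⟪g u, ξ⟫ : ℝ) * Complex.I)‖ := by
    simp only [intervalIntegral.integral_of_le zero_le_one]
    refine (StronglyMeasurable.integral_prod_right' (f := fun p : (V × V) × ℝ =>
      Complex.exp ((p.2 * ⟪p.1.1 - p.1.2, ξ⟫ + ⟪g p.2, ξ⟫ : ℝ) * Complex.I)) ?_).measurable.norm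
    exact Measurable.stronglyMeasurable (by fun_prop)
  obtain ⟨η, hη, hle⟩ := exists_lt_one_eventually_integral_le (μ := μ.prod μ)
    (S := {z | ⟪z.1 - z.2, e⟫ ≠ 0}) measurable_integral (fun _ _ => norm_nonneg _)
    (fun ξ z => (norm_integral_cexp_mul_I_le _ zero_le_one).trans_eq (sub_zero 1))
    (measurableSet_eq_fun (by fun_prop) measurable_const).compl
    (fun h₀ => he (h.ae_inner_toll_eq_zero (ae_iff.2 h₀))) hθ fun z hz => hosc _ hz
  exact ⟨η, hη, hle.mono fun ξ hξ => (h.norm_charFun_le_integral ξ).trans hξ⟩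

end IsQuicksortLaw

end QuicksortLaws

section BivariateQuicksort

open Bornology Filter Set
open scoped RealInnerProductSpace

variable {κ : ℝ}

theorem measurable_bivariateToll (κ : ℝ) : Measurable (bivariateToll κ) := by
  unfold bivariateToll
  refine Measurable.add (Measurable.smul_const (by fun_prop) _)
    ((WithLp.measurable_toLp 2 _).comp (measurable_pi_lambda _ fun i => ?_))
  fin_cases i
  · exact measurable_const
  · exact measurable_id.mul (measurable_const.sub measurable_id)

theorem inner_bivariateToll (κ u : ℝ) (ξ : Plane) :
    ⟪bivariateToll κ u, ξ⟫ =
      -(κ * (2 * ξ 0 + ξ 1 / 3)) * Real.binEntropy u + ξ 1 * (u * (1 - u)) + ξ 0 := by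
  simp only [bivariateToll, PiLp.inner_apply, PiLp.add_apply, PiLp.smul_apply, smul_eq_mul,
    RCLike.inner_apply, Real.ringHom_apply, Fin.sum_univ_two, Matrix.cons_val_zero,
    Matrix.cons_val_one, Matrix.cons_val_fin_one,
    Real.binEntropy_eq_negMulLog_add_negMulLog_one_sub, Real.negMulLog]
  ring

theorem continuous_inner_bivariateToll (κ : ℝ) (ξ : Plane) :
    Continuous fun u => ⟪bivariateToll κ u, ξ⟫ := by
  simp only [inner_bivariateToll]
  fun_prop

theorem not_ae_inner_bivariateToll_eq_zero (κ : ℝ) {ξ : Plane} (hξ : ξ 0 ≠ 0) :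
    ¬ ∀ᵐ u ∂volume.restrict (Ioc (0 : ℝ) 1), ⟪bivariateToll κ u, ξ⟫ = 0 := by
  intro h
  have eqOn := Measure.eqOn_Ioc_of_ae_eq (f := fun u => ⟪bivariateToll κ u, ξ⟫) (g := 0)
    volume h (continuous_inner_bivariateToll κ ξ).continuousOn continuousOn_const
  exact hξ (by simpa [inner_bivariateToll] using eqOn (right_mem_Ioc.2 zero_lt_one))

/-- The coefficients of `tollPhase` in the characteristic function of the Quicksort law at `ξ`,
conditionally on `Z₁ - Z₂ = z`. -/
noncomputable def phaseCoefficients (κ : ℝ) (z : Plane) : Plane →ₗ[ℝ] ℝ × ℝ × ℝ where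
  toFun ξ := (⟪z, ξ⟫, κ * (2 * ξ 0 + ξ 1 / 3), ξ 1)
  map_add' ξ ζ := by
    simp only [inner_add_right, PiLp.add_apply, Prod.mk_add_mk]
    ring_nf
  map_smul' c ξ := by
    simp only [real_inner_smul_right, PiLp.smul_apply, smul_eq_mul, RingHom.id_apply,
      Prod.smul_mk]
    ring_nf

theorem phaseCoefficients_injective {z : Plane} (hz : z 0 ≠ 0) :
    Function.Injective (phaseCoefficients κ z) := by
  refine (injective_iff_map_eq_zero _).2 fun ξ hξ => ?_
  simp only [phaseCoefficients, LinearMap.coe_mk, AddHom.coe_mk, Prod.mk_eq_zero,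
    PiLp.inner_apply, Fin.sum_univ_two] at hξ
  obtain ⟨inner_eq, -, snd_eq⟩ := hξ
  ext i
  fin_cases i
  · simpa [snd_eq, hz] using inner_eq
  · exact snd_eq

theorem tendsto_phaseCoefficients_cobounded {z : Plane} (hz : z 0 ≠ 0) :
    Tendsto (phaseCoefficients κ z) (cobounded Plane) (cobounded (ℝ × ℝ × ℝ)) := by
  obtain ⟨c, -, hc⟩ := (phaseCoefficients κ z).exists_antilipschitzWith
    (LinearMap.ker_eq_bot.2 (phaseCoefficients_injective hz))
  exact hc.tendsto_cobounded

theorem norm_integral_cexp_inner_bivariateToll (κ : ℝ) (z ξ : Plane) :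
    ‖∫ u in (0 : ℝ)..1, Complex.exp ((u * ⟪z, ξ⟫ + ⟪bivariateToll κ u, ξ⟫ : ℝ) * Complex.I)‖ =
      ‖∫ u in (0 : ℝ)..1, Complex.exp
        (tollPhase (phaseCoefficients κ z ξ).1 (phaseCoefficients κ z ξ).2.1
          (phaseCoefficients κ z ξ).2.2 u * Complex.I)‖ := by
  have factor (u : ℝ) :
      Complex.exp ((u * ⟪z, ξ⟫ + ⟪bivariateToll κ u, ξ⟫ : ℝ) * Complex.I) =
        Complex.exp (ξ 0 * Complex.I) * Complex.exp
          (tollPhase (phaseCoefficients κ z ξ).1 (phaseCoefficients κ z ξ).2.1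
            (phaseCoefficients κ z ξ).2.2 u * Complex.I) := by
    rw [← Complex.exp_add, ← add_mul, ← Complex.ofReal_add, inner_bivariateToll]
    simp only [tollPhase, phaseCoefficients, LinearMap.coe_mk, AddHom.coe_mk]
    ring_nf
  simp only [factor]
  rw [intervalIntegral.integral_const_mul, norm_mul, Complex.norm_exp_ofReal_mul_I, one_mul]

theorem IsQuicksortLaw.exists_pow_mul_norm_charFun_le {μ : Measure Plane} [IsProbabilityMeasure μ]
    (h : IsQuicksortLaw (bivariateToll κ) μ) (k : ℕ) :
    ∃ C : ℝ, ∀ ξ, ‖ξ‖ ^ k * ‖charFun μ ξ‖ ≤ C := by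
  obtain ⟨η, hη, hle⟩ := h.exists_lt_one_eventually_norm_charFun_le
    (e := EuclideanSpace.single 0 1) (θ := 31 / 32)
    (not_ae_inner_bivariateToll_eq_zero κ (by simp)) (by norm_num) fun z hz => by
      simp only [norm_integral_cexp_inner_bivariateToll]
      exact (tendsto_phaseCoefficients_cobounded
        (by simpa [EuclideanSpace.inner_single_right] using hz)).eventually
          eventually_norm_integral_cexp_tollPhase_le
  exact h.isQuicksortSubsolution_norm_charFun.exists_pow_mul_le hη hle k

theorem SolvesBivariateQuicksort.isQuicksortLaw {Ω Ω' : Type*} [MeasurableSpace Ω]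
    [MeasurableSpace Ω'] {P : Measure Ω} {P' : Measure Ω'} [IsProbabilityMeasure P']
    {Z : Ω → Plane} {Z₁ Z₂ : Ω' → Plane} {U : Ω' → ℝ}
    (h : SolvesBivariateQuicksort κ P P' Z Z₁ Z₂ U) :
    IsQuicksortLaw (bivariateToll κ) (P.map Z) where
  measurable_toll := measurable_bivariateToll κ
  map_eq := by
    have aemeasurable_Z₁ := h.identDistrib_fst.aemeasurable_fst
    have aemeasurable_Z₂ := h.identDistrib_snd.aemeasurable_fst
    have aemeasurable_U : AEMeasurable U P' := h.uniform.aemeasurable (by simp) (by simp)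
    have map_U : P'.map U = volume.restrict (Ioc (0 : ℝ) 1) := by
      rw [show P'.map U = _ from h.uniform, ProbabilityTheory.cond, Real.volume_Ioo, sub_zero,
        ENNReal.ofReal_one, inv_one, one_smul, Measure.restrict_congr_set Ioo_ae_eq_Ioc]
    have map_pair := (indepFun_iff_map_prod_eq_prod_map_map aemeasurable_Z₁ aemeasurable_Z₂).1
      h.indep_copies
    have map_triple := (indepFun_iff_map_prod_eq_prod_map_map
      (aemeasurable_Z₁.prodMk aemeasurable_Z₂) aemeasurable_U).1 h.indep_uniform
    rw [map_pair, h.identDistrib_fst.map_eq, h.identDistrib_snd.map_eq, map_U] at map_triple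
    rw [← map_triple, AEMeasurable.map_map_of_aemeasurable
      (measurable_quicksortMap (measurable_bivariateToll κ)).aemeasurable
      ((aemeasurable_Z₁.prodMk aemeasurable_Z₂).prodMk aemeasurable_U)]
    exact h.equation.map_eq.symm

end BivariateQuicksort

theorem mainTheorem6 (κ : ℝ) {Ω Ω' : Type*} [MeasurableSpace Ω] [MeasurableSpace Ω']
    (P : Measure Ω) [IsProbabilityMeasure P] (P' : Measure Ω') [IsProbabilityMeasure P']
    (Z : Ω → Plane) (Z₁ Z₂ : Ω' → Plane) (U : Ω' → ℝ)
    (h : SolvesBivariateQuicksort κ P P' Z Z₁ Z₂ U) :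
    ∃ f : Plane → ℝ, ContDiff ℝ ∞ f ∧ (∃ C : ℝ, ∀ x, |f x| ≤ C) ∧ (∀ x, 0 ≤ f x) ∧
      P.map Z = volume.withDensity (fun x => ENNReal.ofReal (f x)) := by
  have : IsProbabilityMeasure (P.map Z) :=
    Measure.isProbabilityMeasure_map h.equation.aemeasurable_fst
  have decay := h.isQuicksortLaw.exists_pow_mul_norm_charFun_le
  have hΦ := integrable_measureFourier decay
  exact ⟨fourierDensity (P.map Z),
    contDiff_fourierDensity fun k _ => integrable_pow_mul_norm_measureFourier decay k,
    ⟨_, abs_fourierDensity_le⟩, fourierDensity_nonneg hΦ, (withDensity_fourierDensity hΦ).symm⟩
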